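/- For a field $K$ of characteristic $0$ with algebraic closure $\bar K$ and an elliptic curve $(E,O)$ over $K$, let $E[n]=\{P\in E(\bar K): nP=O\}$ and $E[\infty]=\bigcup_{n\ge 1}E[n]$. Consider all tuples $(K,E_1,O_1,\pi_1,E_2,O_2,\pi_2)$ where $K$ is a field of characteristic $0$, $(E_1,O_1)$ and $(E_2,O_2)$ are elliptic curves over $K$, and each $\pi_i\in K(E_i)$ is an even morphism $\pi_i:E_i\to\mathbb{P}^1$ of degree $2$ (that is, $\pi_i(-P)=\pi_i(P)$ and $[K(E_i):K(\pi_i)]=2$). Then $$\sup_{\{(K,E_1,O_1,\pi_1,E_2,O_2,\pi_2)\,:\,\pi_1(E_1[2])\neq\pi_2(E_2[2])\}}\#\bigl(\pi_1(E_1[\infty])\cap\pi_2(E_2[\infty])\bigr)\;\ge\;14,$$ where the images and the intersection are taken in $\mathbb{P}^1(\bar K)$. -/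

import Mathlib

universe u

open scoped LinearAlgebra.Projectivization

noncomputable section

namespace EllTorsion

variable {K : Type u} [Field K]

/-- The group `E(K̄)` of points of `E` over an algebraic closure `K̄` of `K`, with the point at
infinity `O` as zero. -/
abbrev GeomPoint (E : WeierstrassCurve K) : Type u :=
  (E.baseChange (AlgebraicClosure K)).toAffine.Point

open scoped Classical in
/-- The chord-and-tangent group law on `E(K̄)` (Mathlib's). -/
instance (E : WeierstrassCurve K) : AddCommGroup (GeomPoint E) :=
  WeierstrassCurve.Affine.Point.instAddCommGroup

/-- The set `E[n]` of points `P` of `E` over `K̄` with `n • P = O`. -/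
def torsionPoints (E : WeierstrassCurve K) (n : ℕ) : Set (GeomPoint E) :=
  {P | n • P = 0}

/-- The set `E[∞]` of all points of finite order of `E` over `K̄`. -/
def allTorsionPoints (E : WeierstrassCurve K) : Set (GeomPoint E) :=
  {P | ∃ n : ℕ, 0 < n ∧ n • P = 0}

/-- Homogeneous coordinates `(X : Y : Z)` of a point of `E`, with `O = (0 : 1 : 0)`. -/
def homogCoords {E : WeierstrassCurve K} : GeomPoint E → Fin 3 → AlgebraicClosure K
  | .zero => ![0, 1, 0]
  | .some x y _ => ![x, y, 1]

/-- The coordinate function `x` in the function field `K(E)`. -/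
def coordX (E : WeierstrassCurve K) : E.toAffine.FunctionField :=
  algebraMap E.toAffine.CoordinateRing E.toAffine.FunctionField
    (WeierstrassCurve.Affine.CoordinateRing.mk E.toAffine (Polynomial.C Polynomial.X))

/-- The coordinate function `y` in the function field `K(E)`. -/
def coordY (E : WeierstrassCurve K) : E.toAffine.FunctionField :=
  algebraMap E.toAffine.CoordinateRing E.toAffine.FunctionField
    (WeierstrassCurve.Affine.CoordinateRing.mk E.toAffine Polynomial.X)

/-- The rational function `f ∈ K(E)`, viewed as a morphism `E → ℙ¹`, takes the value `t` at `P`: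
there are forms `A`, `B` over `K` of the same degree, not both vanishing at `P`, with
`f = A / B` in `K(E)` and `t = (A(P) : B(P))`.
(If `B` were zero in `K(E)`, then so would be `A`, and both would vanish at `P`.) -/
def HasValueAt {E : WeierstrassCurve K} (f : E.toAffine.FunctionField) (P : GeomPoint E)
    (t : ℙ (AlgebraicClosure K) (Fin 2 → AlgebraicClosure K)) : Prop :=
  ∃ (d : ℕ) (A B : MvPolynomial (Fin 3) K), A.IsHomogeneous d ∧ B.IsHomogeneous d ∧
    f * MvPolynomial.aeval ![coordX E, coordY E, 1] B =
      MvPolynomial.aeval ![coordX E, coordY E, 1] A ∧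
    ∃ h : ![MvPolynomial.aeval (homogCoords P) A, MvPolynomial.aeval (homogCoords P) B] ≠ 0,
      t = Projectivization.mk (AlgebraicClosure K) _ h

/-- The degree `[K(E) : K(f)]` of a rational function `f ∈ K(E)`, viewed as a morphism `E → ℙ¹`
(for constant `f` that extension is infinite and the value is `0`). -/
def degree {E : WeierstrassCurve K} (f : E.toAffine.FunctionField) : ℕ :=
  Module.finrank (IntermediateField.adjoin K {f}) E.toAffine.FunctionField

/-- The map on `K̄`-points `π : E(K̄) → ℙ¹(K̄)` is (induced by) an even morphism `E → ℙ¹` of degree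
`2` defined over `K`, that is, by an even element `f` of degree `2` of the function field `K(E)`. -/
def IsEvenDoubleCover {E : WeierstrassCurve K}
    (π : GeomPoint E → ℙ (AlgebraicClosure K) (Fin 2 → AlgebraicClosure K)) : Prop :=
  ∃ f : E.toAffine.FunctionField,
    (∀ P, HasValueAt f P (π P)) ∧ (∀ P, π (-P) = π P) ∧ degree f = 2

end EllTorsion

end

namespace EllTorsion

/-! ### The function field `K(x, y)` and the degree of `x`. -/

section FunctionField

open WeierstrassCurve.Affine Polynomial IntermediateField

variable {K : Type u} [Field K]

/-! For each parameter `a`, the double cover of the `z`-line branched at `±a, ±1/a` is an elliptic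
curve `E_a` with origin over `a`. The branch points are the images of `E_a[2]`. The symmetries `z ↦
-z` and `z ↦ 1/z` come from translations by 2-torsion, and their fixed points `0, ∞, ±1, ±i` are the
images of the points of order 4, whatever `a` is. So any two such curves share six torsion images.

Eight more come from making the branch points of each curve torsion on the other. It suffices that
`±b, ±1/b` lie under points of `E_a` whose doubles lie over `z = 1`, and symmetrically. With `A = a
+ 1/a` and `B = b + 1/b` this reads `B² = 2A`, `A² = 2B`, solved by `A = 2w²`, `B = 2w` with `w` a
primitive cube root of unity (`GoodPair.exists_of_isAlgClosed`). Torsion is checked through the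
duplication formula in the coordinate `z` (`IsCurve.isTorsionX_of_double`), and
`enumCommon_injective` shows that the `6 + 8` points are distinct. -/

lemma algebraMap_mk_C (E : WeierstrassCurve K) (p : K[X]) :
    algebraMap E.toAffine.CoordinateRing E.toAffine.FunctionField
      (CoordinateRing.mk E.toAffine (C p)) = aeval (coordX E) p := by
  induction p using Polynomial.induction_on' with
  | add p q hp hq => simp only [map_add, hp, hq]
  | monomial n a =>
    rw [← C_mul_X_pow_eq_monomial]
    simp only [map_mul, map_pow, aeval_C, aeval_X]
    rfl

lemma algebraMap_basis (E : WeierstrassCurve K) (p q : K[X]) :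
    algebraMap E.toAffine.CoordinateRing E.toAffine.FunctionField
      (p • (1 : E.toAffine.CoordinateRing) + q • CoordinateRing.mk E.toAffine X) =
      aeval (coordX E) p + aeval (coordX E) q * coordY E := by
  simp only [CoordinateRing.smul, map_add, map_mul, mul_one, algebraMap_mk_C]
  rfl

lemma aeval_add_aeval_mul_coordY_eq_zero {E : WeierstrassCurve K} {p q : K[X]}
    (h : aeval (coordX E) p + aeval (coordX E) q * coordY E = 0) : p = 0 ∧ q = 0 := by
  rw [← algebraMap_basis, FaithfulSMul.algebraMap_eq_zero_iff] at h
  exact CoordinateRing.smul_basis_eq_zero h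

lemma aeval_coordX_eq_zero {E : WeierstrassCurve K} {p : K[X]}
    (h : aeval (coordX E) p = 0) : p = 0 :=
  (aeval_add_aeval_mul_coordY_eq_zero (E := E) (p := p) (q := 0) (by simpa using h)).1

lemma coordX_ne_algebraMap (E : WeierstrassCurve K) (c : K) :
    coordX E ≠ algebraMap K E.toAffine.FunctionField c := by
  intro h
  refine X_sub_C_ne_zero c (aeval_coordX_eq_zero (E := E) ?_)
  simp [h]

lemma coord_equation (E : WeierstrassCurve K) :
    coordY E ^ 2 + algebraMap K _ E.a₁ * coordX E * coordY E + algebraMap K _ E.a₃ * coordY E =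
      coordX E ^ 3 + algebraMap K _ E.a₂ * coordX E ^ 2 + algebraMap K _ E.a₄ * coordX E +
        algebraMap K _ E.a₆ := by
  have h : algebraMap E.toAffine.CoordinateRing E.toAffine.FunctionField
      (CoordinateRing.mk E.toAffine (X ^ 2 + C (C E.a₁ * X + C E.a₃) * X -
        C (X ^ 3 + C E.a₂ * X ^ 2 + C E.a₄ * X + C E.a₆))) = 0 := by
    rw [← WeierstrassCurve.Affine.polynomial]
    exact (congrArg _ AdjoinRoot.mk_self).trans (map_zero _)
  have hY : algebraMap E.toAffine.CoordinateRing E.toAffine.FunctionField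
      (CoordinateRing.mk E.toAffine X) = coordY E := rfl
  rw [map_sub, map_add, map_mul, map_pow, map_sub, map_add, map_mul, map_pow, hY,
    algebraMap_mk_C, algebraMap_mk_C] at h
  simp only [map_add, map_mul, map_pow, aeval_C, aeval_X] at h
  linear_combination h

/-- Clearing denominators in `y = r(x)/s(x)` contradicts the independence of `1, y` over `K[x]`. -/
lemma coordY_notMem_adjoin (E : WeierstrassCurve K) : coordY E ∉ K⟮coordX E⟯ := by
  rw [mem_adjoin_simple_iff]
  rintro ⟨r, s, h⟩
  by_cases hs : s = 0
  · subst hs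
    have := aeval_add_aeval_mul_coordY_eq_zero (E := E) (p := 0) (q := 1) (by simp [h])
    exact one_ne_zero this.2
  · have hs' : aeval (coordX E) s ≠ 0 := fun h0 => hs (aeval_coordX_eq_zero h0)
    refine hs (aeval_add_aeval_mul_coordY_eq_zero (E := E) (p := -r) (q := s) ?_).2
    rw [h]
    field_simp
    simp

lemma adjoin_coordX_coordY (E : WeierstrassCurve K) :
    IntermediateField.adjoin K⟮coordX E⟯ {coordY E} = ⊤ := by
  have hx (p : K[X]) : aeval (coordX E) p ∈ IntermediateField.adjoin K⟮coordX E⟯ {coordY E} := by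
    have : aeval (coordX E) p ∈ K⟮coordX E⟯ :=
      (mem_adjoin_simple_iff K _).2 ⟨p, 1, by simp⟩
    exact (IntermediateField.adjoin K⟮coordX E⟯ {coordY E}).algebraMap_mem ⟨_, this⟩
  have hR (z : E.toAffine.CoordinateRing) : algebraMap _ E.toAffine.FunctionField z ∈
      IntermediateField.adjoin K⟮coordX E⟯ {coordY E} := by
    obtain ⟨p, q, rfl⟩ := CoordinateRing.exists_smul_basis_eq z
    rw [algebraMap_basis]
    exact add_mem (hx p) (mul_mem (hx q) (mem_adjoin_simple_self _ _))
  refine eq_top_iff.2 fun z _ => ?_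
  obtain ⟨n, d, -, rfl⟩ := IsFractionRing.div_surjective (A := E.toAffine.CoordinateRing) z
  exact div_mem (hR n) (hR d)

lemma finrank_adjoin_eq_two_of_quadratic {M F : Type*} [Field M] [Field F] [Algebra M F]
    {y : F} {b c : M} (h : y ^ 2 + algebraMap M F b * y + algebraMap M F c = 0)
    (hy : y ∉ (algebraMap M F).range) : Module.finrank M M⟮y⟯ = 2 := by
  let P : M[X] := X ^ 2 + (C b * X + C c)
  have hmonic : P.Monic := monic_X_pow_add (lt_of_le_of_lt degree_linear_le (by norm_num))
  have hdeg : P.natDegree = 2 := by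
    simp only [P, ← add_assoc]
    simpa using natDegree_quadratic (R := M) (a := 1) (b := b) (c := c) one_ne_zero
  have hroot : aeval y P = 0 := by
    simp only [P, map_add, map_mul, map_pow, aeval_C, aeval_X]
    linear_combination h
  have hint : IsIntegral M y := ⟨P, hmonic, hroot⟩
  rw [adjoin.finrank hint]
  refine le_antisymm ?_ ((minpoly.two_le_natDegree_iff hint).2 hy)
  exact hdeg ▸ natDegree_le_of_dvd (minpoly.dvd M _ hroot) hmonic.ne_zero

/-- The coordinate `x` has degree `2` as a morphism to the projective line. -/
lemma degree_coordX (E : WeierstrassCurve K) : degree (coordX E) = 2 := by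
  let x : K⟮coordX E⟯ := ⟨coordX E, mem_adjoin_simple_self K _⟩
  have h := finrank_adjoin_eq_two_of_quadratic (M := K⟮coordX E⟯) (y := coordY E)
    (b := algebraMap K _ E.a₁ * x + algebraMap K _ E.a₃)
    (c := -(x ^ 3 + algebraMap K _ E.a₂ * x ^ 2 + algebraMap K _ E.a₄ * x + algebraMap K _ E.a₆))
    (by
      have hx : algebraMap K⟮coordX E⟯ E.toAffine.FunctionField x = coordX E := rfl
      simp only [map_add, map_neg, map_mul, map_pow, hx, ← IsScalarTower.algebraMap_apply]
      linear_combination coord_equation E)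
    (fun ⟨z, hz⟩ => coordY_notMem_adjoin E (hz ▸ z.2))
  rwa [adjoin_coordX_coordY, finrank_top'] at h

end FunctionField

/-! ### The curve with its double cover of the `z`-line. -/

noncomputable section Cover

open WeierstrassCurve.Affine IntermediateField

variable {K : Type u} [Field K]

/-- The curve `y² = x (x - m) (x - 1/m)` with `m = (1 + a²) / (1 - a²)`; the substitution
`x = (z + a) / (z - a)` turns it into the double cover of the `z`-line branched over
`±a` and `±1/a`, with the origin over `a`. -/
@[simps]
def curve (a : K) : WeierstrassCurve K where
  a₁ := 0
  a₂ := -(2 * (1 + a ^ 4) / (1 - a ^ 4))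
  a₃ := 0
  a₄ := 1
  a₆ := 0

lemma curve_isElliptic [CharZero K] {a : K} (h0 : a ≠ 0) (h4 : a ^ 4 ≠ 1) :
    (curve a).IsElliptic := by
  refine ⟨isUnit_iff_ne_zero.2 ?_⟩
  have h4' : 1 - a ^ 4 ≠ 0 := sub_ne_zero.2 h4.symm
  have : (curve a).Δ = 256 * a ^ 4 / (1 - a ^ 4) ^ 2 := by
    simp only [WeierstrassCurve.Δ, WeierstrassCurve.b₂, WeierstrassCurve.b₄, WeierstrassCurve.b₆,
      WeierstrassCurve.b₈, curve]
    field_simp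
    ring
  rw [this]
  exact div_ne_zero (mul_ne_zero (by norm_num) (pow_ne_zero _ h0)) (pow_ne_zero _ h4')

/-- Homogeneous coordinates of `z = a (x + 1) / (x - 1)`. -/
def coverCoords (a : K) : GeomPoint (curve a) → Fin 2 → AlgebraicClosure K
  | .zero => ![algebraMap K _ a, 1]
  | .some x _ _ => ![algebraMap K _ a * (x + 1), x - 1]

lemma moebius_ne_zero {L : Type*} [Field L] [CharZero L] {α : L} (hα : α ≠ 0) (x : L) :
    ![α * (x + 1), x - 1] ≠ 0 := by
  intro h
  have h0 : α * (x + 1) = 0 := congrFun h 0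
  have h1 : x - 1 = 0 := congrFun h 1
  have : x + 1 = 0 := by simpa [hα] using h0
  have : (2 : L) = 0 := by linear_combination this - h1
  exact two_ne_zero this

lemma coverCoords_ne_zero [CharZero K] {a : K} (h0 : a ≠ 0) (P : GeomPoint (curve a)) :
    coverCoords a P ≠ 0 := by
  have h0' : algebraMap K (AlgebraicClosure K) a ≠ 0 := by simpa using h0
  rcases P with _ | ⟨x, y, h⟩
  · exact fun h => one_ne_zero (congrFun h 1)
  · exact moebius_ne_zero h0' x

/-- The double cover `z = a (x + 1) / (x - 1)`. -/
def cover [CharZero K] (a : K) (h0 : a ≠ 0) (P : GeomPoint (curve a)) :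
    ℙ (AlgebraicClosure K) (Fin 2 → AlgebraicClosure K) :=
  Projectivization.mk _ (coverCoords a P) (coverCoords_ne_zero h0 P)

/-- The rational function `z = a (x + 1) / (x - 1)`. -/
def coverFun (a : K) : (curve a).toAffine.FunctionField :=
  algebraMap K _ a * (coordX (curve a) + 1) / (coordX (curve a) - 1)

lemma coordX_sub_one_ne_zero (E : WeierstrassCurve K) : coordX E - 1 ≠ 0 := by
  have := coordX_ne_algebraMap E 1
  rwa [map_one, ← sub_ne_zero] at this

/-- A Möbius transformation is invertible, so it does not change the generated field, hence not the
degree. -/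
lemma adjoin_coverFun [CharZero K] {a : K} (h0 : a ≠ 0) :
    K⟮coverFun a⟯ = K⟮coordX (curve a)⟯ := by
  have hx := coordX_sub_one_ne_zero (curve a)
  have h0' : algebraMap K (curve a).toAffine.FunctionField a ≠ 0 := by simpa using h0
  have : CharZero (curve a).toAffine.FunctionField :=
    charZero_of_injective_algebraMap (algebraMap K _).injective
  apply le_antisymm <;> rw [adjoin_simple_le_iff]
  · have := mem_adjoin_simple_self K (coordX (curve a))
    exact div_mem (mul_mem (_root_.algebraMap_mem _ _) (add_mem this (one_mem _)))
      (sub_mem this (one_mem _))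
  · have hf := mem_adjoin_simple_self K (coverFun a)
    have : coordX (curve a) = (coverFun a + algebraMap K _ a) / (coverFun a - algebraMap K _ a) := by
      rw [coverFun]
      generalize algebraMap K (curve a).toAffine.FunctionField a = α at *
      generalize coordX (curve a) = x at *
      have h1 : α * (x + 1) / (x - 1) - α = 2 * α / (x - 1) := by field_simp; ring
      have h2 : α * (x + 1) / (x - 1) + α = 2 * α * x / (x - 1) := by field_simp; ring
      rw [h1, h2]
      field_simp
    rw [this]
    exact div_mem (add_mem hf (_root_.algebraMap_mem _ _)) (sub_mem hf (_root_.algebraMap_mem _ _))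

lemma cover_hasValueAt [CharZero K] {a : K} (h0 : a ≠ 0) (P : GeomPoint (curve a)) :
    HasValueAt (coverFun a) P (cover a h0 P) := by
  have hx := coordX_sub_one_ne_zero (curve a)
  rcases P with _ | ⟨x, y, h⟩
  -- At `O = (0 : 1 : 0)` the forms `X + Z` and `X - Z` both vanish. Multiplying numerator and
  -- denominator by `x²` and replacing `x³` by `Q`, using the curve equation, gives quadratic forms
  -- that do not vanish there.
  · let Q : MvPolynomial (Fin 3) K := MvPolynomial.X 1 ^ 2 -
      MvPolynomial.C (curve a).a₂ * MvPolynomial.X 0 ^ 2 - MvPolynomial.X 0 * MvPolynomial.X 2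
    have hX (i : Fin 3) : (MvPolynomial.X i ^ 2 : MvPolynomial (Fin 3) K).IsHomogeneous 2 := by
      simpa using (MvPolynomial.isHomogeneous_X K i).pow 2
    have hQ : Q.IsHomogeneous 2 :=
      ((hX 1).sub ((hX 0).C_mul _)).sub
        ((MvPolynomial.isHomogeneous_X K 0).mul (MvPolynomial.isHomogeneous_X K 2))
    refine ⟨2, MvPolynomial.C a * (Q + MvPolynomial.X 0 ^ 2), Q - MvPolynomial.X 0 ^ 2,
      (hQ.add (hX 0)).C_mul a, hQ.sub (hX 0), ?_, ?_⟩
    · have hE := coord_equation (curve a)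
      have hQ' : MvPolynomial.aeval ![coordX (curve a), coordY (curve a), 1] Q =
          coordX (curve a) ^ 3 := by
        simp only [Q, map_sub, map_mul, map_pow, MvPolynomial.aeval_X, MvPolynomial.aeval_C,
          Matrix.cons_val]
        simp only [curve_a₁, curve_a₃, curve_a₄, curve_a₆, map_zero, map_one] at hE
        linear_combination hE
      simp only [map_sub, map_add, map_mul, map_pow, MvPolynomial.aeval_X, MvPolynomial.aeval_C,
        hQ', Matrix.cons_val, coverFun]
      field_simp
    · have hv : ![MvPolynomial.aeval (homogCoords (.zero : GeomPoint (curve a)))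
            (MvPolynomial.C a * (Q + MvPolynomial.X 0 ^ 2)),
          MvPolynomial.aeval (homogCoords (.zero : GeomPoint (curve a)))
            (Q - MvPolynomial.X 0 ^ 2)] = coverCoords a .zero := by
        simp [Q, homogCoords, coverCoords]
      exact ⟨hv ▸ coverCoords_ne_zero h0 _, by simp only [cover, hv]⟩
  · have hX (i : Fin 3) : (MvPolynomial.X i : MvPolynomial (Fin 3) K).IsHomogeneous 1 :=
      MvPolynomial.isHomogeneous_X K i
    let A : MvPolynomial (Fin 3) K := MvPolynomial.C a * (MvPolynomial.X 0 + MvPolynomial.X 2)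
    let B : MvPolynomial (Fin 3) K := MvPolynomial.X 0 - MvPolynomial.X 2
    refine ⟨1, A, B, ((hX 0).add (hX 2)).C_mul a, (hX 0).sub (hX 2), ?_, ?_⟩
    · simp only [A, B, map_sub, map_add, map_mul, MvPolynomial.aeval_X, MvPolynomial.aeval_C,
        Matrix.cons_val, coverFun]
      field_simp
    · have hv : ![MvPolynomial.aeval (homogCoords (.some x y h : GeomPoint (curve a))) A,
          MvPolynomial.aeval (homogCoords (.some x y h : GeomPoint (curve a))) B] =
            coverCoords a (.some x y h) := by
        simp [A, B, homogCoords, coverCoords]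
      exact ⟨hv ▸ coverCoords_ne_zero h0 _, by simp only [cover, hv]⟩

lemma cover_isEvenDoubleCover [CharZero K] {a : K} (h0 : a ≠ 0) :
    IsEvenDoubleCover (cover a h0) := by
  refine ⟨coverFun a, cover_hasValueAt h0, fun P => ?_, ?_⟩
  · rcases P with _ | ⟨x, y, h⟩ <;> rfl
  · have h := degree_coordX (curve a)
    rw [degree] at h ⊢
    rwa [adjoin_coverFun h0]

end Cover

/-! ### Torsion criteria in terms of the `x`-coordinate. -/

section Torsion

open WeierstrassCurve.Affine

/-- All points of `W` with first coordinate `x` have finite order. -/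
def IsTorsionX {F : Type*} [Field F] [DecidableEq F] (W : WeierstrassCurve.Affine F) (x : F) :
    Prop :=
  ∀ y (h : W.Nonsingular x y), ∃ n : ℕ, 0 < n ∧ n • (Point.some x y h) = 0

/-- Duplication formula on a curve `y² = x³ + a₂ x² + x`. -/
lemma isTorsionX_of_double {F : Type*} [Field F] [DecidableEq F] [CharZero F]
    {W : WeierstrassCurve.Affine F} (h1 : W.a₁ = 0) (h3 : W.a₃ = 0) (h4 : W.a₄ = 1)
    (h6 : W.a₆ = 0) {x x' : F} (hx' : IsTorsionX W x')
    (h : 4 * (x ^ 3 + W.a₂ * x ^ 2 + x) * x' = (x ^ 2 - 1) ^ 2) : IsTorsionX W x := by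
  intro y hP
  have hE := (W.equation_iff x y).1 hP.1
  simp only [h1, h3, h4, h6] at hE
  have hneg : W.negY x y = -y := by simp [negY, h1, h3]
  -- If `y = 0` the point is 2-torsion; otherwise `h` identifies `x'` as the `x`-coordinate of its
  -- double.
  by_cases hy : y = 0
  · exact ⟨2, two_pos, by
      rw [two_nsmul]
      exact Point.add_self_of_Y_eq (by rw [hneg, hy, neg_zero])⟩
  · have hy' : y ≠ W.negY x y := by rwa [hneg, Ne, self_eq_neg]
    have hX : W.addX x x (W.slope x x y y) = x' := by
      rw [slope_of_Y_ne rfl hy', hneg, addX, h1, h4]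
      have h2 : y - -y = 2 * y := by ring
      have : 4 * y ^ 2 ≠ 0 := mul_ne_zero (by norm_num) (pow_ne_zero _ hy)
      rw [h2]
      apply mul_left_cancel₀ this
      field_simp
      linear_combination -h - 4 * (x' + 2 * x + W.a₂) * hE
    have hadd := Point.add_self_of_Y_ne (h₁ := hP) hy'
    obtain ⟨n, hn, hn'⟩ := hx' _ (hX ▸ nonsingular_add hP hP fun hxy => hy' hxy.2)
    refine ⟨n * 2, by positivity, ?_⟩
    rw [mul_nsmul', two_nsmul, hadd]
    convert hn'

lemma isTorsionX_of_root {F : Type*} [Field F] [DecidableEq F] [CharZero F]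
    {W : WeierstrassCurve.Affine F} (h1 : W.a₁ = 0) (h3 : W.a₃ = 0) (h4 : W.a₄ = 1)
    (h6 : W.a₆ = 0) {x : F} (h : x ^ 3 + W.a₂ * x ^ 2 + x = 0) : IsTorsionX W x := by
  intro y hP
  have hE := (W.equation_iff x y).1 hP.1
  simp only [h1, h3, h4, h6] at hE
  have hy : y = 0 := pow_eq_zero_iff two_ne_zero |>.1 (by linear_combination hE + h)
  exact ⟨2, two_pos, by
    rw [two_nsmul]
    exact Point.add_self_of_Y_eq (by simp [negY, h1, h3, hy])⟩

end Torsion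

/-- Conditions on `a` and `b` under which the branch points `±b`, `±1/b` of one cover are torsion
for the other, and vice versa. -/
structure GoodPair {F : Type*} [Field F] (a b : F) : Prop where
  left_ne_zero : a ≠ 0
  right_ne_zero : b ≠ 0
  left_pow_ne_one : a ^ 4 ≠ 1
  right_pow_ne_one : b ^ 4 ≠ 1
  sq_ne_sq : a ^ 2 ≠ b ^ 2
  sq_mul_sq_ne_one : a ^ 2 * b ^ 2 ≠ 1
  rel : (b ^ 2 + 1) ^ 2 * a = 2 * (a ^ 2 + 1) * b ^ 2
  rel' : (a ^ 2 + 1) ^ 2 * b = 2 * (b ^ 2 + 1) * a ^ 2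

/-! ### Existence of a good pair of parameters. -/

namespace GoodPair

lemma symm {F : Type*} [Field F] {a b : F} (h : GoodPair a b) : GoodPair b a :=
  ⟨h.2, h.1, h.4, h.3, h.5.symm, by rw [mul_comm]; exact h.6, h.8, h.7⟩

lemma map {F L : Type*} [Field F] [Field L] {a b : F} (h : GoodPair a b) (f : F →+* L) :
    GoodPair (f a) (f b) := by
  have hf {x y : F} : f x = f y ↔ x = y := f.injective.eq_iff
  refine ⟨?_, ?_, ?_, ?_, ?_, ?_, ?_, ?_⟩
  · simpa using h.1
  · simpa using h.2
  · simpa [← map_pow, ← hf] using h.3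
  · simpa [← map_pow, ← hf] using h.4
  · simpa [← hf] using h.5
  · simpa [← hf] using h.6
  · simpa only [map_mul, map_pow, map_add, map_one, map_ofNat] using congrArg f h.7
  · simpa only [map_mul, map_pow, map_add, map_one, map_ofNat] using congrArg f h.8

/-- The relations say `B² = 2A` and `A² = 2B` for `A = a + 1/a`, `B = b + 1/b`, so `A³ = 8` when `A
≠ 0`. The root `A = 2` would give `a = 1`, a degenerate curve, so a primitive cube root of unity `w`
is used. -/
lemma exists_of_isAlgClosed (K : Type*) [Field K] [IsAlgClosed K] [CharZero K] :
    ∃ a b : K, GoodPair a b := by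
  obtain ⟨s, hs⟩ := IsAlgClosed.exists_pow_nat_eq (-3 : K) two_pos
  obtain ⟨w, hw⟩ : ∃ w : K, w ^ 2 + w + 1 = 0 :=
    ⟨(-1 + s) / 2, by field_simp; linear_combination hs⟩
  obtain ⟨t, ht⟩ := IsAlgClosed.exists_pow_nat_eq (w - 1) two_pos
  obtain ⟨r, hr⟩ := IsAlgClosed.exists_pow_nat_eq (w ^ 2 - 1) two_pos
  have hw0 : w ≠ 0 := by rintro rfl; simp at hw
  have hw1 : w - 1 ≠ 0 := by
    intro h
    have : (3 : K) = 0 := by linear_combination hw - (w + 2) * h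
    exact three_ne_zero this
  -- The quadratics `a + 1/a = 2w²` and `b + 1/b = 2w` have discriminants proportional to `w⁴ - 1 =
  -- w - 1` and `w² - 1`, hence `t` and `r`.
  have ha : (w ^ 2 + t) ^ 2 + 1 = 2 * w ^ 2 * (w ^ 2 + t) := by
    linear_combination ht - w * (w - 1) * hw
  have hb : (w + r) ^ 2 + 1 = 2 * w * (w + r) := by linear_combination hr
  generalize w ^ 2 + t = a at ha
  generalize w + r = b at hb
  have ha0 : a ≠ 0 := by rintro rfl; simp at ha
  have hb0 : b ≠ 0 := by rintro rfl; simp at hb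
  have hw3 : w ^ 3 = 1 := by linear_combination (w - 1) * hw
  -- This is `a²b²(A² - B²)`, which also factors as `(a² - b²)(a²b² - 1)`; its nonvanishing gives
  -- both separation conditions.
  have key : a ^ 2 * b ^ 2 * (4 * w * (1 - w)) =
      (a ^ 2 + 1) ^ 2 * b ^ 2 - (b ^ 2 + 1) ^ 2 * a ^ 2 := by
    rw [ha, hb]
    linear_combination -4 * w * a ^ 2 * b ^ 2 * hw3
  have hne : a ^ 2 * b ^ 2 * (4 * w * (1 - w)) ≠ 0 :=
    mul_ne_zero (mul_ne_zero (pow_ne_zero _ ha0) (pow_ne_zero _ hb0))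
      (mul_ne_zero (mul_ne_zero (by norm_num) hw0) (sub_ne_zero.2 (sub_ne_zero.1 hw1).symm))
  refine ⟨a, b, ha0, hb0, ?_, ?_, ?_, ?_, ?_, ?_⟩
  · intro h4
    have : (a ^ 2 + 1) * (a ^ 2 - 1) = 0 := by linear_combination h4
    rcases mul_eq_zero.1 this with h | h
    · rw [ha] at h
      exact mul_ne_zero (mul_ne_zero two_ne_zero (pow_ne_zero _ hw0)) ha0 h
    · have h1 : a * w ^ 2 = 1 := mul_left_cancel₀ two_ne_zero (by linear_combination h - ha)
      have h2 : a = w := by linear_combination w * h1 - a * hw3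
      subst h2
      exact hw1 (by linear_combination hw3 - a * h)
  · intro h4
    have : (b ^ 2 + 1) * (b ^ 2 - 1) = 0 := by linear_combination h4
    rcases mul_eq_zero.1 this with h | h
    · rw [hb] at h
      exact mul_ne_zero (mul_ne_zero two_ne_zero hw0) hb0 h
    · have h1 : b * w = 1 := mul_left_cancel₀ two_ne_zero (by linear_combination h - hb)
      have h2 : w ^ 2 = 1 := by linear_combination (b * w + 1) * h1 - w ^ 2 * h
      have h3 : w - 1 = 0 := by linear_combination hw3 - w * h2
      exact hw1 h3
  · intro h
    apply hne
    rw [key]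
    linear_combination (1 - a ^ 2 * b ^ 2) * (-h)
  · intro h
    apply hne
    rw [key]
    linear_combination (a ^ 2 - b ^ 2) * h
  · rw [ha, hb]
    ring
  · rw [ha, hb]
    linear_combination 4 * w * b * a ^ 2 * hw3

end GoodPair

/-! ### Torsion on the curve, read in the coordinate `z`. -/

section TorsionOfCover

open WeierstrassCurve.Affine

variable {F : Type*} [Field F] {W : WeierstrassCurve.Affine F} {α : F}

/-- `W` is the curve `EllTorsion.curve α`, up to the shape of its coefficients. -/
structure IsCurve (W : WeierstrassCurve.Affine F) (α : F) : Prop where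
  a₁ : W.a₁ = 0
  a₂ : W.a₂ = -(2 * (1 + α ^ 4) / (1 - α ^ 4))
  a₃ : W.a₃ = 0
  a₄ : W.a₄ = 1
  a₆ : W.a₆ = 0

/-- Here `x = (z + α)/(z - α)` inverts the cover, and the numerator vanishes at the branch points.
-/
lemma IsCurve.cubic_eq (hW : IsCurve W α) (h4 : α ^ 4 ≠ 1) {z : F} (hz : z ≠ α) :
    ((z + α) / (z - α)) ^ 3 + W.a₂ * ((z + α) / (z - α)) ^ 2 + (z + α) / (z - α) =
      4 * α ^ 2 * (1 - α ^ 2 * z ^ 2) * (z ^ 2 - α ^ 2) / ((z - α) ^ 4 * (1 - α ^ 4)) := by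
  have h4' : 1 - α ^ 4 ≠ 0 := sub_ne_zero.2 h4.symm
  have hz' : z - α ≠ 0 := sub_ne_zero.2 hz
  rw [hW.a₂]
  field_simp
  ring

variable [CharZero F] [DecidableEq F]

lemma IsCurve.isTorsionX_of_branch (hW : IsCurve W α) (h4 : α ^ 4 ≠ 1) {z : F} (hz : z ≠ α)
    (h : (1 - α ^ 2 * z ^ 2) * (z ^ 2 - α ^ 2) = 0) : IsTorsionX W ((z + α) / (z - α)) := by
  apply isTorsionX_of_root hW.a₁ hW.a₃ hW.a₄ hW.a₆
  rw [hW.cubic_eq h4 hz, mul_assoc _ (1 - _), h]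
  simp

/-- Since `x² - 1 = 4αz/(z - α)²`, duplication becomes `x(2P) = z²(1 - α⁴)/((1 - α²z²)(z² - α²))`,
invariant under `z ↦ -z` and `z ↦ 1/z`. -/
lemma IsCurve.isTorsionX_of_double (hW : IsCurve W α) (h4 : α ^ 4 ≠ 1) {z x' : F} (hz : z ≠ α)
    (hx' : IsTorsionX W x')
    (h : x' * ((1 - α ^ 2 * z ^ 2) * (z ^ 2 - α ^ 2)) = z ^ 2 * (1 - α ^ 4)) :
    IsTorsionX W ((z + α) / (z - α)) := by
  have h4' : 1 - α ^ 4 ≠ 0 := sub_ne_zero.2 h4.symm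
  have hz' : z - α ≠ 0 := sub_ne_zero.2 hz
  apply EllTorsion.isTorsionX_of_double hW.a₁ hW.a₃ hW.a₄ hW.a₆ hx'
  rw [hW.cubic_eq h4 hz]
  field_simp
  linear_combination 16 * α ^ 2 * h

lemma IsCurve.isTorsionX_zero (hW : IsCurve W α) : IsTorsionX W 0 :=
  isTorsionX_of_root hW.a₁ hW.a₃ hW.a₄ hW.a₆ (by ring)

lemma IsCurve.isTorsionX_of_sq_eq_one (hW : IsCurve W α) {x : F} (hx : x ^ 2 = 1) :
    IsTorsionX W x :=
  EllTorsion.isTorsionX_of_double hW.a₁ hW.a₃ hW.a₄ hW.a₆ hW.isTorsionX_zero (by rw [hx]; ring)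

omit [CharZero F] [DecidableEq F] in
lemma sq_ne_one_of_pow_four (h4 : α ^ 4 ≠ 1) : α ^ 2 ≠ 1 ∧ α ^ 2 ≠ -1 :=
  ⟨fun h => h4 (by linear_combination (α ^ 2 + 1) * h),
    fun h => h4 (by linear_combination (α ^ 2 - 1) * h)⟩

/-- These are points of order 4: those over `z = ±1` double to the 2-torsion point over `1/α`, those
over `z² = -1` to the one over `-1/α`. -/
lemma IsCurve.isTorsionX_of_pow_four_eq_one (hW : IsCurve W α) (h0 : α ≠ 0) (h4 : α ^ 4 ≠ 1)
    {z : F} (hz : z ^ 4 = 1) : IsTorsionX W ((z + α) / (z - α)) := by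
  have hzα : z ≠ α := by rintro rfl; exact h4 hz
  obtain ⟨h1, h2⟩ := sq_ne_one_of_pow_four h4
  have h1' : 1 - α ^ 2 ≠ 0 := sub_ne_zero.2 h1.symm
  have h2' : 1 + α ^ 2 ≠ 0 := fun h => h2 (by linear_combination h)
  have h3 : (z ^ 2 - 1) * (z ^ 2 + 1) = 0 := by linear_combination hz
  rcases mul_eq_zero.1 h3 with h | h
  · have hx : α⁻¹ ≠ α := fun h => h1 (by field_simp at h; exact h.symm)
    refine hW.isTorsionX_of_double h4 hzα (hW.isTorsionX_of_branch h4 hx ?_) ?_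
    · field_simp; ring
    · have : (α⁻¹ + α) / (α⁻¹ - α) = (1 + α ^ 2) / (1 - α ^ 2) := by field_simp
      rw [this, sub_eq_zero.1 h]
      field_simp
      ring
  · have hx : -α⁻¹ ≠ α := fun h => h2 (by field_simp at h; linear_combination -h)
    refine hW.isTorsionX_of_double h4 hzα (hW.isTorsionX_of_branch h4 hx ?_) ?_
    · field_simp; ring
    · have h2'' : -1 - α ^ 2 ≠ 0 := fun h => h2' (by linear_combination -h)
      have : (-α⁻¹ + α) / (-α⁻¹ - α) = (1 - α ^ 2) / (1 + α ^ 2) := by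
        have : -α⁻¹ - α = -(1 + α ^ 2) / α := by field_simp; ring
        rw [this]
        field_simp
        ring
      rw [this, eq_neg_of_add_eq_zero_left h]
      field_simp
      ring

/-- The relation says that the double lies over `z = 1`, so such a point has order 8. -/
lemma IsCurve.isTorsionX_of_rel (hW : IsCurve W α) (h0 : α ≠ 0) (h4 : α ^ 4 ≠ 1)
    {z : F} (hz : z ≠ α) (h : (z ^ 2 + 1) ^ 2 * α = 2 * (α ^ 2 + 1) * z ^ 2) :
    IsTorsionX W ((z + α) / (z - α)) := by
  have h1 : 1 - α ≠ 0 := fun h => h4 (by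
    rw [← sub_eq_zero.1 h]; ring)
  refine hW.isTorsionX_of_double h4 hz
    (hW.isTorsionX_of_pow_four_eq_one h0 h4 (z := 1) (by norm_num)) ?_
  field_simp
  linear_combination -α * (1 + α) * h

end TorsionOfCover

/-! ### Fourteen common torsion images. -/

noncomputable section Intersection

variable {K : Type u} [Field K] [CharZero K] {a b : K}

/-- The point of the projective line with affine coordinate `z`, where `none` stands for `∞`. -/
def linePoint {L : Type*} [Field L] : Option L → ℙ L (Fin 2 → L)
  | none => Projectivization.mk L ![1, 0] fun h => one_ne_zero (congrFun h 0)
  | some z => Projectivization.mk L ![z, 1] fun h => one_ne_zero (congrFun h 1)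

lemma linePoint_injective {L : Type*} [Field L] :
    Function.Injective (linePoint : Option L → ℙ L (Fin 2 → L)) := by
  rintro (_ | z) (_ | w) h
  · rfl
  · obtain ⟨c, hc⟩ := (Projectivization.mk_eq_mk_iff' _ _ _ _ _).1 h
    have h1 : c = 0 := by simpa using congrFun hc 1
    have h0 : c * w = 1 := by simpa using congrFun hc 0
    simp [h1] at h0
  · obtain ⟨c, hc⟩ := (Projectivization.mk_eq_mk_iff' _ _ _ _ _).1 h
    simpa using congrFun hc 1
  · obtain ⟨c, hc⟩ := (Projectivization.mk_eq_mk_iff' _ _ _ _ _).1 h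
    have h1 : c = 1 := by simpa using congrFun hc 1
    have h0 : c * w = z := by simpa using congrFun hc 0
    rw [← h0, h1, one_mul]

lemma isCurve_baseChange (a : K) :
    IsCurve ((curve a).baseChange (AlgebraicClosure K)).toAffine
      (algebraMap K (AlgebraicClosure K) a) := by
  constructor <;> simp [WeierstrassCurve.map, WeierstrassCurve.baseChange, map_ofNat (algebraMap K _) 2]

-- `IsTorsionX` is vacuous when no point has abscissa `x`; algebraic closedness supplies one.
open scoped Classical in
lemma exists_torsion_cover_eq (h0 : a ≠ 0) (h4 : a ^ 4 ≠ 1) {x : AlgebraicClosure K}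
    (hx : IsTorsionX ((curve a).baseChange (AlgebraicClosure K)).toAffine x) :
    Projectivization.mk _ _ (moebius_ne_zero (α := algebraMap K (AlgebraicClosure K) a)
      (by simpa using h0) x) ∈ cover a h0 '' allTorsionPoints (curve a) := by
  have := curve_isElliptic h0 h4
  let W := ((curve a).baseChange (AlgebraicClosure K)).toAffine
  have : W.IsElliptic :=
    inferInstanceAs ((curve a).map (algebraMap K (AlgebraicClosure K))).IsElliptic
  obtain ⟨y, hy⟩ := IsAlgClosed.exists_pow_nat_eq
    (x ^ 3 + W.a₂ * x ^ 2 + W.a₄ * x + W.a₆) two_pos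
  have hc := isCurve_baseChange a
  have hE : W.Equation x y := by
    rw [W.equation_iff, hc.a₁, hc.a₃]
    linear_combination hy
  have hE' := W.equation_iff_nonsingular.1 hE
  exact ⟨.some x y hE', hx y hE', rfl⟩

open scoped Classical in
lemma linePoint_mem_of_isTorsionX (h0 : a ≠ 0) (h4 : a ^ 4 ≠ 1) {z : AlgebraicClosure K}
    (hz : z ≠ algebraMap K _ a)
    (hx : IsTorsionX ((curve a).baseChange (AlgebraicClosure K)).toAffine
      ((z + algebraMap K _ a) / (z - algebraMap K _ a))) :
    linePoint (some z) ∈ cover a h0 '' allTorsionPoints (curve a) := by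
  have hα : algebraMap K (AlgebraicClosure K) a ≠ 0 := by simpa using h0
  convert exists_torsion_cover_eq h0 h4 hx using 1
  rw [linePoint, Projectivization.mk_eq_mk_iff']
  generalize algebraMap K (AlgebraicClosure K) a = α at *
  have hz' : z - α ≠ 0 := sub_ne_zero.2 hz
  refine ⟨(z - α) / (2 * α), ?_⟩
  ext i
  fin_cases i
  · simp; field_simp; ring
  · simp; field_simp; ring

lemma linePoint_none_mem (h0 : a ≠ 0) (h4 : a ^ 4 ≠ 1) :
    linePoint none ∈ cover a h0 '' allTorsionPoints (curve a) := by
  classical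
  have hα : algebraMap K (AlgebraicClosure K) a ≠ 0 := by simpa using h0
  convert exists_torsion_cover_eq h0 h4
    ((isCurve_baseChange a).isTorsionX_of_sq_eq_one (one_pow 2)) using 1
  rw [linePoint, Projectivization.mk_eq_mk_iff']
  refine ⟨(2 * algebraMap K (AlgebraicClosure K) a)⁻¹, ?_⟩
  ext i
  fin_cases i
  · simp; field_simp; norm_num
  · simp

lemma cover_zero (h0 : a ≠ 0) : cover a h0 0 = linePoint (some (algebraMap K _ a)) := rfl

lemma linePoint_self_mem (h0 : a ≠ 0) :
    linePoint (some (algebraMap K _ a)) ∈ cover a h0 '' allTorsionPoints (curve a) :=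
  ⟨0, ⟨1, one_pos, smul_zero _⟩, cover_zero h0⟩

/-- The affine coordinates of common torsion images of the covers attached to a good pair. -/
def commonSet {L : Type*} [Field L] (α β : L) : Set L :=
  {z | z = 0 ∨ z ^ 4 = 1 ∨ z ^ 2 = α ^ 2 ∨ z ^ 2 = (α ^ 2)⁻¹ ∨ z ^ 2 = β ^ 2 ∨ z ^ 2 = (β ^ 2)⁻¹}

lemma commonSet_comm {L : Type*} [Field L] (α β : L) : commonSet α β = commonSet β α := by
  ext z
  simp only [commonSet, Set.mem_ofPred_eq]
  tauto

lemma linePoint_mem_of_mem_commonSet (h : GoodPair a b) {z : AlgebraicClosure K}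
    (hz : z ∈ commonSet (algebraMap K _ a) (algebraMap K _ b)) :
    linePoint (some z) ∈ cover a h.left_ne_zero '' allTorsionPoints (curve a) := by
  classical
  by_cases hzα : z = algebraMap K _ a
  · rw [hzα]
    exact linePoint_self_mem h.left_ne_zero
  refine linePoint_mem_of_isTorsionX h.left_ne_zero h.left_pow_ne_one hzα ?_
  have hc := isCurve_baseChange a
  have h' := h.map (algebraMap K (AlgebraicClosure K))
  generalize algebraMap K (AlgebraicClosure K) a = α at *
  generalize algebraMap K (AlgebraicClosure K) b = β at *
  have hα := h'.left_ne_zero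
  have hβ := h'.right_ne_zero
  rcases hz with rfl | hz | hz | hz | hz | hz
  · refine hc.isTorsionX_of_sq_eq_one ?_
    field_simp
    ring
  · exact hc.isTorsionX_of_pow_four_eq_one hα h'.left_pow_ne_one hz
  · exact hc.isTorsionX_of_branch h'.left_pow_ne_one hzα (by rw [hz]; ring)
  · exact hc.isTorsionX_of_branch h'.left_pow_ne_one hzα (by rw [hz]; field_simp; ring)
  · exact hc.isTorsionX_of_rel hα h'.left_pow_ne_one hzα (by rw [hz]; exact h'.rel)
  · refine hc.isTorsionX_of_rel hα h'.left_pow_ne_one hzα ?_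
    rw [hz]
    field_simp
    linear_combination h'.rel

/-- An enumeration of fourteen points with coordinates in `commonSet α β ∪ {∞}`, if `ι² = -1`. -/
def enumCommon {L : Type*} [Field L] (ι α β : L) : Option (Option (Fin 6 × Bool)) → Option L
  | none => none
  | some none => some 0
  | some (some (j, e)) => some ((if e then 1 else -1) * ![1, ι, α, α⁻¹, β, β⁻¹] j)

lemma injective_one_neg_one_inv {L : Type*} [Field L] [CharZero L] {A B : L} (hA : A ≠ 0)
    (hB : B ≠ 0) (hA2 : A ^ 2 ≠ 1) (hB2 : B ^ 2 ≠ 1) (hAB : A ≠ B) (hAB1 : A * B ≠ 1) :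
    Function.Injective ![1, -1, A, A⁻¹, B, B⁻¹] := by
  have aux {C : L} (hC : C ≠ 0) (hC2 : C ^ 2 ≠ 1) :
      1 ≠ C ∧ -1 ≠ C ∧ 1 ≠ C⁻¹ ∧ -1 ≠ C⁻¹ ∧ C ≠ C⁻¹ := by
    refine ⟨?_, ?_, ?_, ?_, ?_⟩ <;> intro h <;> apply hC2
    · rw [← h, one_pow]
    · rw [← h, neg_one_sq]
    · rw [← inv_inv C, ← h, inv_one, one_pow]
    · rw [← inv_inv C, ← h, inv_neg, inv_one, neg_one_sq]
    · rw [sq]; nth_rw 1 [h]; exact inv_mul_cancel₀ hC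
  obtain ⟨a1, a2, a3, a4, a5⟩ := aux hA hA2
  obtain ⟨b1, b2, b3, b4, b5⟩ := aux hB hB2
  have c1 : (1 : L) ≠ -1 := fun h => two_ne_zero (α := L) (by linear_combination h)
  have c2 : A ≠ B⁻¹ := fun h => hAB1 (by rw [h, inv_mul_cancel₀ hB])
  have c3 : A⁻¹ ≠ B := fun h => hAB1 (by rw [← h, mul_inv_cancel₀ hA])
  have c4 : A⁻¹ ≠ B⁻¹ := fun h => hAB (inv_injective h)
  have key (j k : Fin 6) (hjk : j < k) : (![1, -1, A, A⁻¹, B, B⁻¹] : Fin 6 → L) j ≠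
      (![1, -1, A, A⁻¹, B, B⁻¹] : Fin 6 → L) k := by
    fin_cases j <;> fin_cases k <;> first | exact absurd hjk (by decide) | assumption
  intro j k hjk
  rcases lt_trichotomy j k with h | h | h
  · exact absurd hjk (key j k h)
  · exact h
  · exact absurd hjk.symm (key k j h)

lemma enumCommon_injective {L : Type*} [Field L] [CharZero L] {ι α β : L} (hι : ι ^ 2 = -1)
    (h : GoodPair α β) : Function.Injective (enumCommon ι α β) := by
  have hα := h.left_ne_zero
  have hβ := h.right_ne_zero
  have hι0 : ι ≠ 0 := by rintro rfl; simp at hι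
  let v : Fin 6 → L := ![1, ι, α, α⁻¹, β, β⁻¹]
  have h0 (j : Fin 6) : v j ≠ 0 := by
    fin_cases j <;> simp [v, hα, hβ, hι0]
  -- Squaring removes the sign, so it suffices that `1, -1, α², α⁻², β², β⁻²` are distinct.
  have hsq {j k : Fin 6} (hjk : v j ^ 2 = v k ^ 2) : j = k := by
    refine injective_one_neg_one_inv (pow_ne_zero 2 hα) (pow_ne_zero 2 hβ) ?_ ?_ h.sq_ne_sq
      h.sq_mul_sq_ne_one ?_
    · rw [← pow_mul]; exact h.left_pow_ne_one
    · rw [← pow_mul]; exact h.right_pow_ne_one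
    · have (j : Fin 6) :
          (![1, -1, α ^ 2, (α ^ 2)⁻¹, β ^ 2, (β ^ 2)⁻¹] : Fin 6 → L) j = v j ^ 2 := by
        fin_cases j <;> simp [v, hι]
      rw [this, this, hjk]
  have hs (e : Bool) : ((if e then 1 else -1 : L)) ≠ 0 := by cases e <;> simp
  have hs2 (e : Bool) : ((if e then 1 else -1 : L)) ^ 2 = 1 := by cases e <;> simp
  have hs3 {e f : Bool} (hef : (if e then 1 else -1 : L) = if f then 1 else -1) : e = f := by
    have hne : (1 : L) ≠ -1 := fun h => two_ne_zero (α := L) (by linear_combination h)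
    cases e <;> cases f
    · rfl
    · exact absurd hef.symm hne
    · exact absurd hef hne
    · rfl
  have hz (j : Fin 6) (e : Bool) : (if e then 1 else -1) * v j ≠ 0 := mul_ne_zero (hs e) (h0 j)
  rintro (_ | _ | ⟨j, e⟩) (_ | _ | ⟨k, f⟩) hxy
  · rfl
  · cases hxy
  · cases hxy
  · cases hxy
  · rfl
  · exact absurd (Option.some.inj hxy).symm (hz k f)
  · cases hxy
  · exact absurd (Option.some.inj hxy) (hz j e)
  · have hxy' : (if e then 1 else -1) * v j = (if f then 1 else -1) * v k := Option.some.inj hxy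
    have hjk : j = k := hsq (by
      have := congrArg (· ^ 2) hxy'
      simpa only [mul_pow, hs2, one_mul] using this)
    subst hjk
    rw [hs3 (mul_right_cancel₀ (h0 j) hxy')]

lemma enumCommon_mem {L : Type*} [Field L] {ι α β : L} (hι : ι ^ 2 = -1)
    (t : Option (Fin 6 × Bool)) : ∃ z ∈ commonSet α β, enumCommon ι α β (some t) = some z := by
  rcases t with _ | ⟨j, e⟩
  · exact ⟨0, Or.inl rfl, rfl⟩
  · refine ⟨_, ?_, rfl⟩
    have hs2 : ((if e then 1 else -1 : L)) ^ 2 = 1 := by cases e <;> simp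
    have hs4 : ((if e then 1 else -1 : L)) ^ 4 = 1 := by
      rw [show 4 = 2 * 2 from rfl, pow_mul, hs2, one_pow]
    have hι4 : ι ^ 4 = 1 := by linear_combination (ι ^ 2 - 1) * hι
    simp only [commonSet, Set.mem_ofPred_eq, mul_pow, hs2, hs4, one_mul]
    fin_cases j <;> simp [hι4]

lemma encard_image_inter_ge (h : GoodPair a b) {ι : K} (hι : ι ^ 2 = -1) :
    14 ≤ (cover a h.left_ne_zero '' allTorsionPoints (curve a) ∩
      cover b h.right_ne_zero '' allTorsionPoints (curve b)).encard := by
  let f := algebraMap K (AlgebraicClosure K)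
  have hι' : f ι ^ 2 = -1 := by rw [← map_pow, hι, map_neg, map_one]
  have hinj : Function.Injective (linePoint ∘ enumCommon (f ι) (f a) (f b)) :=
    linePoint_injective.comp (enumCommon_injective hι' (h.map f))
  have hcard : (Set.range (linePoint ∘ enumCommon (f ι) (f a) (f b))).encard = 14 := by
    rw [← Set.image_univ, hinj.encard_image, Set.encard_univ, ENat.card_eq_coe_fintype_card]
    rfl
  rw [← hcard]
  apply Set.encard_le_encard
  rintro _ ⟨_ | t, rfl⟩
  · exact ⟨linePoint_none_mem _ h.left_pow_ne_one, linePoint_none_mem _ h.right_pow_ne_one⟩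
  · obtain ⟨z, hz, hzt⟩ := enumCommon_mem (α := f a) (β := f b) hι' t
    rw [Function.comp_apply, hzt]
    exact ⟨linePoint_mem_of_mem_commonSet h hz,
      linePoint_mem_of_mem_commonSet h.symm (commonSet_comm (f a) (f b) ▸ hz)⟩

/-- The 2-torsion of the second curve lies over `±b, ±1/b`, and `a² ≠ b²`, `a²b² ≠ 1` exclude `a`.
-/
lemma linePoint_notMem_image_two_torsion (h : GoodPair a b) :
    linePoint (some (algebraMap K _ a)) ∉ cover b h.right_ne_zero '' torsionPoints (curve b) 2 := by
  classical
  have h' := h.map (algebraMap K (AlgebraicClosure K))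
  have hc := isCurve_baseChange b
  rintro ⟨P, hP, hPa⟩
  have hne : algebraMap K (AlgebraicClosure K) a ≠ algebraMap K (AlgebraicClosure K) b :=
    fun hab => h'.sq_ne_sq (by rw [hab])
  rcases P with _ | ⟨x, y, hxy⟩
  · exact hne (Option.some.inj (linePoint_injective hPa)).symm
  · have hneg : (WeierstrassCurve.Affine.Point.some x y hxy : GeomPoint (curve b)) =
        -.some x y hxy := eq_neg_of_add_eq_zero_left ((two_nsmul _).symm.trans hP)
    rw [WeierstrassCurve.Affine.Point.neg_some, WeierstrassCurve.Affine.Point.some.injEq] at hneg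
    have hy : y = -y := by simpa [WeierstrassCurve.Affine.negY, hc.a₁, hc.a₃] using hneg.2
    have hy0 : y = 0 := self_eq_neg.1 hy
    have hE := (WeierstrassCurve.Affine.equation_iff x y).1 hxy.1
    simp only [hc.a₁, hc.a₃, hc.a₄, hc.a₆, hy0] at hE
    rw [cover, linePoint, Projectivization.mk_eq_mk_iff'] at hPa
    obtain ⟨c, hca⟩ := hPa
    generalize algebraMap K (AlgebraicClosure K) a = α at *
    have hc0 : c * α = algebraMap K _ b * (x + 1) := congrFun hca 0
    have hc1 : c * 1 = x - 1 := congrFun hca 1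
    generalize algebraMap K (AlgebraicClosure K) b = β at *
    have hd : α - β ≠ 0 := sub_ne_zero.2 hne
    have hx : x = (α + β) / (α - β) := by
      rw [eq_div_iff hd]
      linear_combination hc0 - α * hc1
    have hcubic := hc.cubic_eq h'.right_pow_ne_one hne
    rw [← hx, show x ^ 3 + _ * x ^ 2 + x = 0 by linear_combination -hE, eq_comm] at hcubic
    have h1 : 1 - β ^ 2 * α ^ 2 ≠ 0 := by
      rw [mul_comm]
      exact sub_ne_zero.2 h'.sq_mul_sq_ne_one.symm
    exact div_ne_zero (mul_ne_zero (mul_ne_zero (mul_ne_zero (by norm_num)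
      (pow_ne_zero 2 h'.right_ne_zero)) h1) (sub_ne_zero.2 h'.sq_ne_sq))
      (mul_ne_zero (pow_ne_zero 4 hd) (sub_ne_zero.2 h'.right_pow_ne_one.symm)) hcubic

end Intersection
end EllTorsion

theorem theorem18 :
    (14 : ℕ∞) ≤
      ⨆ (K : Type u) (_ : Field K) (_ : CharZero K)
        (E₁ : WeierstrassCurve K) (_ : E₁.IsElliptic)
        (π₁ : EllTorsion.GeomPoint E₁ → ℙ (AlgebraicClosure K) (Fin 2 → AlgebraicClosure K))
        (_ : EllTorsion.IsEvenDoubleCover π₁)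
        (E₂ : WeierstrassCurve K) (_ : E₂.IsElliptic)
        (π₂ : EllTorsion.GeomPoint E₂ → ℙ (AlgebraicClosure K) (Fin 2 → AlgebraicClosure K))
        (_ : EllTorsion.IsEvenDoubleCover π₂)
        (_ : π₁ '' EllTorsion.torsionPoints E₁ 2 ≠ π₂ '' EllTorsion.torsionPoints E₂ 2),
        (π₁ '' EllTorsion.allTorsionPoints E₁ ∩ π₂ '' EllTorsion.allTorsionPoints E₂).encard := by
  let K := AlgebraicClosure (ULift.{u} ℚ)
  have : CharZero (ULift.{u} ℚ) :=
    charZero_of_injective_algebraMap (algebraMap ℚ (ULift.{u} ℚ)).injective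
  have : CharZero K :=
    charZero_of_injective_algebraMap (algebraMap (ULift.{u} ℚ) K).injective
  obtain ⟨a, b, h⟩ := EllTorsion.GoodPair.exists_of_isAlgClosed K
  obtain ⟨ι, hι⟩ := IsAlgClosed.exists_pow_nat_eq (-1 : K) two_pos
  refine (EllTorsion.encard_image_inter_ge h hι).trans ?_
  refine le_iSup_of_le K <| le_iSup_of_le inferInstance <| le_iSup_of_le inferInstance <|
    le_iSup_of_le (EllTorsion.curve a) <|
    le_iSup_of_le (EllTorsion.curve_isElliptic h.left_ne_zero h.left_pow_ne_one) <|
    le_iSup_of_le _ <| le_iSup_of_le (EllTorsion.cover_isEvenDoubleCover h.left_ne_zero) <|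
    le_iSup_of_le (EllTorsion.curve b) <|
    le_iSup_of_le (EllTorsion.curve_isElliptic h.right_ne_zero h.right_pow_ne_one) <|
    le_iSup_of_le _ <| le_iSup_of_le (EllTorsion.cover_isEvenDoubleCover h.right_ne_zero) <|
    le_iSup_of_le ?_ le_rfl
  -- The point `a` is the image of the origin of the first curve, so it separates the two images of
  -- 2-torsion.
  intro heq
  exact EllTorsion.linePoint_notMem_image_two_torsion h
    (heq ▸ ⟨0, smul_zero _, EllTorsion.cover_zero h.left_ne_zero⟩)
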